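/- Let $A$ be a $C^*$-algebra (not necessarily unital), let $A^{**}$ be its enveloping von Neumann algebra, i.e. the double commutant of $A$ in its universal representation (the direct sum of the GNS representations of all states), and regard the multiplier algebra $M(A)$ as contained in $A^{**}$ in the canonical way. States of $A$ are extended to normal states of $A^{**}$. For $R\subset A^{**}$ let $R_{\mathrm{sa}}=\{x\in R: x^*=x\}$, let $(R_{\mathrm{sa}})^m$ be the set of (strong) limits of bounded increasing nets from $R_{\mathrm{sa}}$, and let $^-$ denote norm closure. An element $h$ of $A^{**}$ is strongly lower semicontinuous if $h\in((A_{\mathrm{sa}})^m)^-$, and strongly upper semicontinuous if $-h$ is strongly lower semicontinuous. Define the following sets of self-adjoint elements of $A^{**}$: - $\overline S$ is the norm closed real vector space generated by the strongly lower semicontinuous elements; - $\mathcal U$ is the set of $x\in A^{**}_{\mathrm{sa}}$ such that for every $\epsilon>0$ and every state $\varphi$ of $A$ there are a strongly lower semicontinuous $h$ and a strongly upper semicontinuous $k$ with $k\le x\le h$ and $\varphi(h-k)<\epsilon$; - $\mathcal U_b$ is the set of $x\in \mathcal U$ for which there is a constant $\gamma$, depending only on $x$, such that $h$ and $k$ can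 always be chosen with $\|h\|,\|k\|\le\gamma$; - $\overline{\mathcal U}_b$ is the norm closure of $\mathcal U_b$; - $\mathcal U_0$ is the monotone sequential closure of $\mathcal U_b$, i.e. the smallest set which contains $\mathcal U_b$ and is closed under limits of bounded increasing and of bounded decreasing sequences. For a set $R$ of self-adjoint elements of $A^{**}$ put $R_{\mathbb C}=R+iR$. Then each of $\overline S_{\mathbb C}$, $\mathcal U_{b\mathbb C}$, $\overline{\mathcal U}_{b\mathbb C}$, $\mathcal U_{0\mathbb C}$ and $\mathcal U_{\mathbb C}$ is an $M(A)$-$M(A)$-bimodule, i.e. a complex linear subspace $V$ of $A^{**}$ with $TV\subset V$ and $VT\subset V$ for all $T\in M(A)$. Moreover, for every $T\in M(A)$ the map $x\mapsto T^*xT$ carries strongly lower (respectively upper) semicontinuous elements to strongly lower (respectively upper) semicontinuous elements, and carries each of $\overline S$, $\mathcal U_b$, $\overline{\mathcal U}_b$, $\mathcal U_0$ and $\mathcal U$ into itself. -/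

import Mathlib

open scoped ComplexOrder InnerProductSpace MultiplierAlgebra ENNReal

noncomputable section

universe u

namespace EnvelopingVN

section Construction

variable {A : Type u} [NonUnitalCStarAlgebra A] [PartialOrder A] [StarOrderedRing A]

/-! ### Multipliers acting on the Gelfand–Naimark–Segal spaces -/

/-- `(m a)* (m a) ≤ ‖m‖² a* a` for a multiplier `m`, tested against a positive functional. -/
lemma apply_fst_le (f : A →ₚ[ℂ] ℂ) (m : 𝓜(ℂ, A)) (a : A) :
    f (star (m.fst a) * m.fst a) ≤ ((‖m‖ ^ 2 : ℝ) : ℂ) * f (star a * a) := by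
  let _ : PartialOrder 𝓜(ℂ, A) := CStarAlgebra.spectralOrder 𝓜(ℂ, A)
  let _ : StarOrderedRing 𝓜(ℂ, A) := CStarAlgebra.spectralOrderedRing 𝓜(ℂ, A)
  have h1 : star m * m ≤ algebraMap ℝ 𝓜(ℂ, A) (‖m‖ ^ 2) := by
    have := CStarAlgebra.star_mul_le_algebraMap_norm_sq (a := m)
    simpa using this
  have h2 : 0 ≤ algebraMap ℝ 𝓜(ℂ, A) (‖m‖ ^ 2) - star m * m := sub_nonneg.mpr h1
  obtain ⟨c, hc⟩ := CStarAlgebra.nonneg_iff_eq_star_mul_self.mp h2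
  have key : ∀ n : 𝓜(ℂ, A), star (n.fst a) * n.fst a = star a * (star n * n).fst a := by
    intro n
    have := n.central (star ((star n).fst (n.fst a))) a
    have e := (star n).central (star a) (n.fst a)
    rw [DoubleCentralizer.star_snd, star_star] at e
    rw [DoubleCentralizer.mul_fst]
    exact e
  have h3 : star (c.fst a) * c.fst a =
      (‖m‖ ^ 2 : ℝ) • (star a * a) - star (m.fst a) * m.fst a := by
    rw [key c, key m, ← hc, DoubleCentralizer.sub_fst, sub_apply, mul_sub]
    congr 1
    rw [Algebra.algebraMap_eq_smul_one, DoubleCentralizer.smul_fst, DoubleCentralizer.one_fst]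
    simp [mul_smul_comm]
  have h4 : 0 ≤ f (star (c.fst a) * c.fst a) := f.map_nonneg (star_mul_self_nonneg _)
  rw [h3, map_sub, sub_nonneg] at h4
  refine h4.trans (le_of_eq ?_)
  rw [← Complex.coe_smul, map_smul, smul_eq_mul]

/-- Left multiplication `a ↦ m a` by a multiplier `m` on the pre-GNS space of `f`. -/
def preGNSMul (f : A →ₚ[ℂ] ℂ) (m : 𝓜(ℂ, A)) : f.PreGNS →L[ℂ] f.PreGNS :=
  LinearMap.mkContinuous
    (f.toPreGNS.toLinearMap ∘ₗ m.fst.toLinearMap ∘ₗ f.ofPreGNS.toLinearMap) ‖m‖ fun x ↦ by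
      rw [← sq_le_sq₀ (by positivity) (by positivity), mul_pow, ← Complex.real_le_real]
      push_cast
      rw [f.preGNS_norm_sq, f.preGNS_norm_sq]
      simpa using apply_fst_le f m (f.ofPreGNS x)

lemma preGNSMul_apply (f : A →ₚ[ℂ] ℂ) (m : 𝓜(ℂ, A)) (x : f.PreGNS) :
    preGNSMul f m x = f.toPreGNS (m.fst (f.ofPreGNS x)) := rfl

/-- The operator on the GNS Hilbert space of `f` which extends `a ↦ m a`. -/
def gnsMul (f : A →ₚ[ℂ] ℂ) (m : 𝓜(ℂ, A)) : f.GNS →L[ℂ] f.GNS :=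
  (preGNSMul f m).completion

lemma gnsMul_coe (f : A →ₚ[ℂ] ℂ) (m : 𝓜(ℂ, A)) (x : f.PreGNS) :
    gnsMul f m (x : f.GNS) = ((f.toPreGNS (m.fst (f.ofPreGNS x)) : f.PreGNS) : f.GNS) := by
  simp [gnsMul, preGNSMul_apply]

lemma norm_gnsMul_le (f : A →ₚ[ℂ] ℂ) (m : 𝓜(ℂ, A)) : ‖gnsMul f m‖ ≤ ‖m‖ := by
  refine ContinuousLinearMap.opNorm_le_bound _ (norm_nonneg _) fun x ↦ ?_
  induction x using UniformSpace.Completion.induction_on with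
  | hp => apply isClosed_le <;> fun_prop
  | ih x =>
    rw [gnsMul, ContinuousLinearMap.completion_apply_coe, UniformSpace.Completion.norm_coe,
      UniformSpace.Completion.norm_coe]
    exact (preGNSMul f m).le_of_opNorm_le (LinearMap.mkContinuous_norm_le _ (norm_nonneg _) _) x

lemma gnsMul_ext (f : A →ₚ[ℂ] ℂ) {S T : f.GNS →L[ℂ] f.GNS}
    (h : ∀ a : A, S ((f.toPreGNS a : f.PreGNS) : f.GNS) = T ((f.toPreGNS a : f.PreGNS) : f.GNS)) :
    S = T := by
  ext x
  induction x using UniformSpace.Completion.induction_on with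
  | hp => apply isClosed_eq <;> fun_prop
  | ih x => exact h (f.ofPreGNS x)

lemma gnsMul_one (f : A →ₚ[ℂ] ℂ) : gnsMul f (1 : 𝓜(ℂ, A)) = 1 :=
  gnsMul_ext f fun a ↦ by simp [gnsMul_coe]

lemma gnsMul_mul (f : A →ₚ[ℂ] ℂ) (m n : 𝓜(ℂ, A)) :
    gnsMul f (m * n) = gnsMul f m * gnsMul f n :=
  gnsMul_ext f fun a ↦ by simp [gnsMul_coe]

lemma gnsMul_add (f : A →ₚ[ℂ] ℂ) (m n : 𝓜(ℂ, A)) :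
    gnsMul f (m + n) = gnsMul f m + gnsMul f n :=
  gnsMul_ext f fun a ↦ by simp [gnsMul_coe, UniformSpace.Completion.coe_add]

lemma gnsMul_smul (f : A →ₚ[ℂ] ℂ) (c : ℂ) (m : 𝓜(ℂ, A)) :
    gnsMul f (c • m) = c • gnsMul f m :=
  gnsMul_ext f fun a ↦ by simp [gnsMul_coe]

lemma gnsMul_star (f : A →ₚ[ℂ] ℂ) (m : 𝓜(ℂ, A)) :
    gnsMul f (star m) = star (gnsMul f m) := by
  rw [ContinuousLinearMap.star_eq_adjoint]
  refine (ContinuousLinearMap.eq_adjoint_iff _ _).mpr fun x y ↦ ?_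
  induction x, y using UniformSpace.Completion.induction_on₂ with
  | hp => apply isClosed_eq <;> fun_prop
  | ih x y =>
    rw [gnsMul_coe, gnsMul_coe, UniformSpace.Completion.inner_coe,
      UniformSpace.Completion.inner_coe, f.preGNS_inner_def, f.preGNS_inner_def]
    congr 1
    have := m.central (star (f.ofPreGNS x)) (f.ofPreGNS y)
    simpa using this

/-! ### States and their cyclic vectors -/

variable (A) in
/-- The states of `A`: the positive linear functionals of norm one. -/
def StateSpace : Type u :=
  {φ : A →ₚ[ℂ] ℂ // ‖(⟨φ.toLinearMap, map_continuous φ⟩ : A →L[ℂ] ℂ)‖ = 1}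

/-- A positive functional is bounded for its own GNS seminorm. -/
lemma exists_norm_apply_le_preGNS (f : A →ₚ[ℂ] ℂ) :
    ∃ C : ℝ, ∀ x : f.PreGNS, ‖f (f.ofPreGNS x)‖ ≤ C * ‖x‖ := by
  obtain ⟨C, hC⟩ := PositiveLinearMap.exists_norm_apply_le f
  refine ⟨√C, fun x ↦ ?_⟩
  have hl := CStarAlgebra.increasingApproximateUnit A
  have hc : Continuous fun a : A ↦ ‖f a‖ := (map_continuous f).norm
  have ht := (hc.tendsto (f.ofPreGNS x)).comp (hl.tendsto_mul_right (f.ofPreGNS x))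
  refine le_of_tendsto ht ?_
  filter_upwards [hl.eventually_star_eq, hl.eventually_norm] with e he he1
  have h1 : f (e * f.ofPreGNS x) = ⟪f.toPreGNS e, x⟫_ℂ := by
    rw [f.preGNS_inner_def, f.ofPreGNS_toPreGNS, he]
  have h2 : ‖f.toPreGNS e‖ ≤ √C := by
    apply Real.le_sqrt_of_sq_le
    have h3 : ((‖f.toPreGNS e‖ ^ 2 : ℝ) : ℂ) = f (star e * e) := by
      push_cast
      exact f.preGNS_norm_sq _
    have h4 : ‖f (star e * e)‖ ≤ C * ‖star e * e‖ := hC _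
    rw [← h3, Complex.norm_real, Real.norm_of_nonneg (by positivity),
      CStarRing.norm_star_mul_self] at h4
    have h5 : ‖e‖ * ‖e‖ ≤ 1 := mul_le_one₀ he1 (norm_nonneg _) he1
    nlinarith [C.coe_nonneg]
  change ‖f (e * f.ofPreGNS x)‖ ≤ _
  rw [h1]
  exact (norm_inner_le_norm _ _).trans (by gcongr)

/-- The functional `a ↦ f a` on the pre-GNS space, extended to the GNS Hilbert space. -/
def gnsFunctional (f : A →ₚ[ℂ] ℂ) : f.GNS →L[ℂ] ℂ :=
  (LinearMap.mkContinuousOfExistsBound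
    (f.toLinearMap ∘ₗ f.ofPreGNS.toLinearMap) (exists_norm_apply_le_preGNS f)).fromCompletion

/-- The cyclic vector `ξ_f` of the GNS representation: the vector with `⟪ξ_f, a⟫ = f a` for `a`
in `A`. -/
def cyclicVector (f : A →ₚ[ℂ] ℂ) : f.GNS :=
  (InnerProductSpace.toDual ℂ f.GNS).symm (gnsFunctional f)

lemma inner_cyclicVector_coe (f : A →ₚ[ℂ] ℂ) (a : A) :
    ⟪cyclicVector f, ((f.toPreGNS a : f.PreGNS) : f.GNS)⟫_ℂ = f a := by
  rw [cyclicVector, InnerProductSpace.toDual_symm_apply, gnsFunctional,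
    ContinuousLinearMap.fromCompletion_apply_coe]
  rfl

/-- The GNS representation maps the cyclic vector to the canonical images of the elements. -/
lemma gns_cyclicVector (f : A →ₚ[ℂ] ℂ) (a : A) :
    f.gnsNonUnitalStarAlgHom a (cyclicVector f) = ((f.toPreGNS a : f.PreGNS) : f.GNS) := by
  refine ext_inner_right ℂ fun y ↦ ?_
  induction y using UniformSpace.Completion.induction_on with
  | hp => apply isClosed_eq <;> fun_prop
  | ih y =>
    rw [← ContinuousLinearMap.adjoint_inner_right, ← ContinuousLinearMap.star_eq_adjoint,
      ← map_star, PositiveLinearMap.gnsNonUnitalStarAlgHom_apply_coe]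
    rw [UniformSpace.Completion.inner_coe, f.preGNS_inner_def]
    exact inner_cyclicVector_coe f (star a * f.ofPreGNS y)

/-! ### The universal representation and the enveloping von Neumann algebra -/

variable (A) in
/-- The Hilbert space of the universal representation: the Hilbert sum of the GNS spaces of all
states. -/
abbrev UnivSpace : Type u := lp (fun φ : StateSpace A ↦ φ.1.GNS) 2

/-- The universal representation `π` of `A`, the direct sum of the GNS representations of all
states. -/
def univRep : A →⋆ₙₐ[ℂ] (UnivSpace A →L[ℂ] UnivSpace A) where
  toFun a := lp.mapCLM 2 (fun φ : StateSpace A ↦ φ.1.gnsNonUnitalStarAlgHom a) (norm_nonneg a)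
    fun φ ↦ NonUnitalStarAlgHom.norm_apply_le φ.1.gnsNonUnitalStarAlgHom a
  map_smul' c a := by ext x φ; simp
  map_zero' := by ext x φ; simp
  map_add' a b := by ext x φ; simp
  map_mul' a b := by ext x φ; simp
  map_star' a := by
    rw [ContinuousLinearMap.star_eq_adjoint]
    refine (ContinuousLinearMap.eq_adjoint_iff _ _).mpr fun x y ↦ ?_
    rw [lp.inner_eq_tsum, lp.inner_eq_tsum]
    refine tsum_congr fun φ ↦ ?_
    change ⟪φ.1.gnsNonUnitalStarAlgHom (star a) (x φ), y φ⟫_ℂ =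
      ⟪x φ, φ.1.gnsNonUnitalStarAlgHom a (y φ)⟫_ℂ
    rw [map_star, ContinuousLinearMap.star_eq_adjoint, ContinuousLinearMap.adjoint_inner_left]

/-- The canonical embedding of the multiplier algebra `M(A)` into operators on the universal
Hilbert space: on each GNS space, `m` acts by `a ↦ m a`. -/
def multRep : 𝓜(ℂ, A) →⋆ₐ[ℂ] (UnivSpace A →L[ℂ] UnivSpace A) where
  toFun m := lp.mapCLM 2 (fun φ : StateSpace A ↦ gnsMul φ.1 m) (norm_nonneg m)
    fun φ ↦ norm_gnsMul_le φ.1 m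
  map_one' := by ext x φ; simp [gnsMul_one]
  map_mul' m n := by ext x φ; simp [gnsMul_mul]
  map_zero' := by
    ext x φ
    have : gnsMul φ.1 (0 : 𝓜(ℂ, A)) = 0 := by simpa using gnsMul_smul φ.1 0 (0 : 𝓜(ℂ, A))
    simp [this]
  map_add' m n := by ext x φ; simp [gnsMul_add]
  commutes' c := by
    ext x φ
    simp [Algebra.algebraMap_eq_smul_one, gnsMul_smul, gnsMul_one]
  map_star' m := by
    rw [ContinuousLinearMap.star_eq_adjoint]
    refine (ContinuousLinearMap.eq_adjoint_iff _ _).mpr fun x y ↦ ?_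
    rw [lp.inner_eq_tsum, lp.inner_eq_tsum]
    refine tsum_congr fun φ ↦ ?_
    simp [gnsMul_star, ContinuousLinearMap.star_eq_adjoint,
      ContinuousLinearMap.adjoint_inner_left]

/-- The embedding of `M(A)` extends the universal representation of `A ⊆ M(A)`. -/
lemma multRep_coe (a : A) : multRep (a : 𝓜(ℂ, A)) = univRep a := by
  ext x φ
  have : gnsMul φ.1 (a : 𝓜(ℂ, A)) = φ.1.gnsNonUnitalStarAlgHom a :=
    gnsMul_ext φ.1 fun b ↦ by simp [gnsMul_coe]
  simp [multRep, univRep, this]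

variable (A) in
/-- The enveloping von Neumann algebra `A**`: the double commutant of the image of `A` in the
universal representation. -/
def bidual : VonNeumannAlgebra (UnivSpace A) where
  toStarSubalgebra := StarSubalgebra.centralizer ℂ
    ((StarSubalgebra.centralizer ℂ (Set.range (univRep (A := A))) :
      StarSubalgebra ℂ (UnivSpace A →L[ℂ] UnivSpace A)) :
      Set (UnivSpace A →L[ℂ] UnivSpace A))
  centralizer_centralizer' := by simp

open Classical in
/-- The normal extension of a state `φ` of `A` to `A**`: the vector state given by the cyclic
vector of `φ`, sitting in the `φ`-th summand of the universal Hilbert space. -/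
def StateSpace.ext (φ : StateSpace A) (x : UnivSpace A →L[ℂ] UnivSpace A) : ℂ :=
  ⟪(lp.single 2 φ (cyclicVector φ.1) : UnivSpace A),
    x (lp.single 2 φ (cyclicVector φ.1) : UnivSpace A)⟫_ℂ

/-- The normal extension of `φ` does extend `φ`. -/
lemma StateSpace.ext_univRep (φ : StateSpace A) (a : A) : φ.ext (univRep a) = φ.1 a := by
  classical
  rw [StateSpace.ext, lp.inner_single_left]
  have : (univRep a (lp.single 2 φ (cyclicVector φ.1) : UnivSpace A)) φ =
      φ.1.gnsNonUnitalStarAlgHom a (cyclicVector φ.1) := by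
    simp [univRep]
  rw [this, gns_cyclicVector, inner_cyclicVector_coe]

end Construction

/-! ### Limits of monotone nets and sequences of operators -/

section Monotone

variable {H : Type u} [NormedAddCommGroup H] [InnerProductSpace ℂ H] [CompleteSpace H]

/-- The family `a` is norm bounded and converges strongly (pointwise) to `x` along `l`. For monotone
families of self-adjoint operators, strong, weak, σ-weak and order convergence agree. -/
def BddTendsto {ι : Type*} (l : Filter ι) (a : ι → H →L[ℂ] H) (x : H →L[ℂ] H) : Prop :=
  (∃ C : ℝ, ∀ i, ‖a i‖ ≤ C) ∧ ∀ ξ : H, Filter.Tendsto (fun i ↦ a i ξ) l (nhds (x ξ))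

/-- `R^m`: the set of limits of bounded increasing nets from `R`. -/
def monoLimits (R : Set (H →L[ℂ] H)) : Set (H →L[ℂ] H) :=
  {x | ∃ (ι : Type u) (_ : Preorder ι) (_ : IsDirectedOrder ι) (_ : Nonempty ι)
    (a : ι → H →L[ℂ] H), Monotone a ∧ (∀ i, a i ∈ R) ∧ BddTendsto Filter.atTop a x}

/-- Membership in the monotone sequential closure of `R`: the smallest set containing `R` and
closed under limits of bounded increasing and of bounded decreasing sequences. -/
inductive MonoSeqClosure (R : Set (H →L[ℂ] H)) : (H →L[ℂ] H) → Prop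
  | base (x : H →L[ℂ] H) : x ∈ R → MonoSeqClosure R x
  | incr (a : ℕ → H →L[ℂ] H) (x : H →L[ℂ] H) : (∀ n, MonoSeqClosure R (a n)) → Monotone a →
      BddTendsto Filter.atTop a x → MonoSeqClosure R x
  | decr (a : ℕ → H →L[ℂ] H) (x : H →L[ℂ] H) : (∀ n, MonoSeqClosure R (a n)) → Antitone a →
      BddTendsto Filter.atTop a x → MonoSeqClosure R x

/-- The complexification `R_ℂ = R + iR`. -/
def complexification (R : Set (H →L[ℂ] H)) : Set (H →L[ℂ] H) :=
  {x | ∃ a ∈ R, ∃ b ∈ R, x = a + Complex.I • b}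

end Monotone

/-! ### Semicontinuity, universal measurability, and the five spaces -/

section Spaces

variable (A : Type u) [NonUnitalCStarAlgebra A] [PartialOrder A] [StarOrderedRing A]

/-- The self-adjoint part of `A`, inside `A**`. -/
def selfAdjointImage : Set (UnivSpace A →L[ℂ] UnivSpace A) :=
  {x | ∃ a : A, IsSelfAdjoint a ∧ x = univRep a}

/-- The strongly lower semicontinuous elements: the norm closure of `(A_sa)^m`. -/
def stronglyLSC : Set (UnivSpace A →L[ℂ] UnivSpace A) :=
  closure (monoLimits (selfAdjointImage A))

/-- The strongly upper semicontinuous elements: the negatives of the lower semicontinuous ones. -/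
def stronglyUSC : Set (UnivSpace A →L[ℂ] UnivSpace A) :=
  {k | -k ∈ stronglyLSC A}

/-- `S̄`: the norm closed real vector space generated by the strongly lower semicontinuous
elements. -/
def Sbar : Set (UnivSpace A →L[ℂ] UnivSpace A) :=
  closure (Submodule.span ℝ (stronglyLSC A) : Set (UnivSpace A →L[ℂ] UnivSpace A))

/-- `𝒰`: the universally measurable self-adjoint elements of `A**`. -/
def univMeas : Set (UnivSpace A →L[ℂ] UnivSpace A) :=
  {x | x ∈ bidual A ∧ IsSelfAdjoint x ∧ ∀ φ : StateSpace A, ∀ ε : ℝ, 0 < ε →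
    ∃ h ∈ stronglyLSC A, ∃ k ∈ stronglyUSC A, k ≤ x ∧ x ≤ h ∧ (φ.ext (h - k)).re < ε}

/-- `𝒰_b`: the elements of `𝒰` for which `h` and `k` can always be taken with norms at most a
constant `γ` which depends only on `x`. -/
def univMeasBdd : Set (UnivSpace A →L[ℂ] UnivSpace A) :=
  {x | x ∈ bidual A ∧ IsSelfAdjoint x ∧ ∃ γ : ℝ, ∀ φ : StateSpace A, ∀ ε : ℝ, 0 < ε →
    ∃ h ∈ stronglyLSC A, ∃ k ∈ stronglyUSC A, k ≤ x ∧ x ≤ h ∧ (φ.ext (h - k)).re < ε ∧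
      ‖h‖ ≤ γ ∧ ‖k‖ ≤ γ}

/-- The norm closure of `𝒰_b`. -/
def univMeasBddBar : Set (UnivSpace A →L[ℂ] UnivSpace A) :=
  closure (univMeasBdd A)

/-- `𝒰₀`: the monotone sequential closure of `𝒰_b`. -/
def univMeasZero : Set (UnivSpace A →L[ℂ] UnivSpace A) :=
  {x | MonoSeqClosure (univMeasBdd A) x}

variable {A}

/-- `V ⊆ A**` is an `M(A)`-`M(A)`-bimodule, i.e. a complex linear subspace of `A**` closed under
left and right multiplication by `M(A) ⊆ A**`. -/
structure IsMultiplierBimodule (V : Set (UnivSpace A →L[ℂ] UnivSpace A)) : Prop where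
  subset_bidual : V ⊆ bidual A
  zero_mem : 0 ∈ V
  add_mem : ∀ x ∈ V, ∀ y ∈ V, x + y ∈ V
  smul_mem : ∀ c : ℂ, ∀ x ∈ V, c • x ∈ V
  mul_left_mem : ∀ m : 𝓜(ℂ, A), ∀ x ∈ V, multRep m * x ∈ V
  mul_right_mem : ∀ m : 𝓜(ℂ, A), ∀ x ∈ V, x * multRep m ∈ V

/-- `V` is mapped into itself by `x ↦ T* x T` for every `T` in `M(A)`. -/
def IsMultiplierInvariant (V : Set (UnivSpace A →L[ℂ] UnivSpace A)) : Prop :=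
  ∀ m : 𝓜(ℂ, A), ∀ x ∈ V, star (multRep m) * x * multRep m ∈ V

end Spaces

end EnvelopingVN

end

open EnvelopingVN

/-!
Fix a multiplier `T` and write `π` for the universal representation. Everything rests on the maps
`x ↦ T* x T`, which are linear, norm continuous, monotone, and continuous along bounded strongly
convergent nets. They map `π(A)` into itself because `A` is an ideal of `M(A)`, hence preserve
`(A_sa)^m`, its norm closure, and the closed real span `S̄`.

For `𝒰` and `𝒰_b`, conjugating `k ≤ x ≤ h` gives `T* k T ≤ T* x T ≤ T* h T`, with norms controlled
by `‖T‖²`. The gap for a state `φ` is `φ(T* (h - k) T)`, the value at `h - k` of a vector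
functional. Restricted to `A`, this functional is a multiple of a state `ψ`; both sides are strongly
continuous, so they agree on semicontinuous elements (`exists_state_inner`), and one chooses `h` and
`k` for `ψ`. That `T* x T` stays in `A**` uses `T ∈ A**` (`multRep_mem_bidual`): an operator
commuting with `π(A)` commutes with `T` on the range of `π(A)`, which is total because `π` is
nondegenerate (`eq_zero_of_mul_univRep`).

The monotone sequential closure of an additive group is again one (`MonoSeqClosure.add`): the
elements which a fixed translation maps into the closure are stable under monotone limits.

Finally, an additive group `V ⊆ A**` invariant under all `x ↦ T* x T` is a real vector space (take
`T` scalar), and the polarization identity expresses `t* x s` by the elements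
`(s + iᵏ t)* x (s + iᵏ t)` of `V`; so `V + iV` is a bimodule
(`isMultiplierBimodule_complexification`).
-/

namespace EnvelopingVN

open Filter Topology

/-! ### Strong limits of bounded nets -/

section StrongLimits

variable {H : Type*} [NormedAddCommGroup H] [InnerProductSpace ℂ H]
  {ι κ : Type*} {l : Filter ι} {a b : ι → H →L[ℂ] H} {x y : H →L[ℂ] H}

lemma BddTendsto.comp_tendsto (h : BddTendsto l a x) {l' : Filter κ} {g : κ → ι}
    (hg : Tendsto g l' l) : BddTendsto l' (fun j ↦ a (g j)) x :=
  ⟨h.1.imp fun _ hC j ↦ hC (g j), fun ξ ↦ (h.2 ξ).comp hg⟩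

lemma BddTendsto.add (ha : BddTendsto l a x) (hb : BddTendsto l b y) :
    BddTendsto l (fun i ↦ a i + b i) (x + y) := by
  obtain ⟨⟨C, hC⟩, ha⟩ := ha
  obtain ⟨⟨D, hD⟩, hb⟩ := hb
  exact ⟨⟨C + D, fun i ↦ norm_add_le_of_le (hC i) (hD i)⟩, fun ξ ↦ (ha ξ).add (hb ξ)⟩

lemma bddTendsto_const (x : H →L[ℂ] H) : BddTendsto l (fun _ ↦ x) x :=
  ⟨⟨‖x‖, fun _ ↦ le_rfl⟩, fun _ ↦ tendsto_const_nhds⟩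

lemma BddTendsto.neg (ha : BddTendsto l a x) : BddTendsto l (fun i ↦ -a i) (-x) := by
  obtain ⟨⟨C, hC⟩, ha⟩ := ha
  exact ⟨⟨C, fun i ↦ by simpa using hC i⟩, fun ξ ↦ (ha ξ).neg⟩

lemma BddTendsto.conj [CompleteSpace H] (ha : BddTendsto l a x) (T : H →L[ℂ] H) :
    BddTendsto l (fun i ↦ star T * a i * T) (star T * x * T) := by
  obtain ⟨⟨C, hC⟩, ha⟩ := ha
  refine ⟨⟨‖star T‖ * C * ‖T‖, fun i ↦ ?_⟩, fun ξ ↦ ?_⟩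
  · refine (norm_mul_le _ _).trans ?_
    gcongr
    refine (norm_mul_le _ _).trans ?_
    gcongr
    exact hC i
  · exact ((star T).continuous.tendsto _).comp (ha (T ξ))

lemma BddTendsto.inner_tendsto (ha : BddTendsto l a x) (ξ η : H) :
    Tendsto (fun i ↦ ⟪ξ, a i η⟫_ℂ) l (𝓝 ⟪ξ, x η⟫_ℂ) :=
  tendsto_const_nhds.inner (ha.2 η)

lemma BddTendsto.commute [l.NeBot] (ha : BddTendsto l a x) {S : H →L[ℂ] H}
    (h : ∀ i, S * a i = a i * S) : S * x = x * S := by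
  ext ξ
  refine tendsto_nhds_unique ((S.continuous.tendsto _).comp (ha.2 ξ)) ?_
  refine (ha.2 (S ξ)).congr fun i ↦ ?_
  exact (DFunLike.congr_fun (h i) ξ).symm

end StrongLimits

/-! ### Closure under monotone limits -/

section MonotoneLimits

universe u
variable {H : Type u} [NormedAddCommGroup H] [InnerProductSpace ℂ H]
  {R R' : Set (H →L[ℂ] H)}

lemma add_mem_monoLimits [CompleteSpace H] (hR : ∀ x ∈ R, ∀ y ∈ R, x + y ∈ R) {x y : H →L[ℂ] H}
    (hx : x ∈ monoLimits R) (hy : y ∈ monoLimits R) : x + y ∈ monoLimits R := by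
  obtain ⟨ι, _, _, _, a, ham, haR, ha⟩ := hx
  obtain ⟨κ, _, _, _, b, hbm, hbR, hb⟩ := hy
  refine ⟨ι × κ, inferInstance, ⟨fun p q ↦ ?_⟩, inferInstance, fun p ↦ a p.1 + b p.2,
    fun p q hpq ↦ add_le_add (ham hpq.1) (hbm hpq.2), fun p ↦ hR _ (haR _) _ (hbR _), ?_⟩
  · obtain ⟨i, hi⟩ := exists_ge_ge p.1 q.1
    obtain ⟨j, hj⟩ := exists_ge_ge p.2 q.2
    exact ⟨(i, j), ⟨hi.1, hj.1⟩, ⟨hi.2, hj.2⟩⟩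
  rw [← prod_atTop_atTop_eq]
  exact (ha.comp_tendsto tendsto_fst).add (hb.comp_tendsto tendsto_snd)

lemma conj_mem_monoLimits [CompleteSpace H] {T : H →L[ℂ] H} (hR : ∀ x ∈ R, star T * x * T ∈ R)
    {x : H →L[ℂ] H} (hx : x ∈ monoLimits R) : star T * x * T ∈ monoLimits R := by
  obtain ⟨ι, _, _, _, a, ham, haR, ha⟩ := hx
  exact ⟨ι, inferInstance, inferInstance, inferInstance, fun i ↦ star T * a i * T,
    fun i j hij ↦ star_left_conjugate_le_conjugate (ham hij) T, fun i ↦ hR _ (haR i), ha.conj T⟩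

lemma MonoSeqClosure.map {f : (H →L[ℂ] H) → (H →L[ℂ] H)} (hf : Monotone f)
    (hlim : ∀ (a : ℕ → H →L[ℂ] H) x, BddTendsto atTop a x →
      BddTendsto atTop (fun n ↦ f (a n)) (f x))
    (hR : ∀ x ∈ R, MonoSeqClosure R' (f x)) {x : H →L[ℂ] H} (hx : MonoSeqClosure R x) :
    MonoSeqClosure R' (f x) := by
  induction hx with
  | base x hx => exact hR x hx
  | incr a x _ hm ha ih => exact .incr _ _ ih (hf.comp hm) (hlim a x ha)
  | decr a x _ hm ha ih => exact .decr _ _ ih (hf.comp_antitone hm) (hlim a x ha)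

lemma MonoSeqClosure.neg [CompleteSpace H] (hR : ∀ x ∈ R, -x ∈ R) {x : H →L[ℂ] H}
    (hx : MonoSeqClosure R x) :
    MonoSeqClosure R (-x) := by
  induction hx with
  | base x hx => exact .base _ (hR x hx)
  | incr a x _ hm ha ih => exact .decr _ _ ih (fun i j hij ↦ neg_le_neg (hm hij)) ha.neg
  | decr a x _ hm ha ih => exact .incr _ _ ih (fun i j hij ↦ neg_le_neg (hm hij)) ha.neg

lemma MonoSeqClosure.conj [CompleteSpace H] {T : H →L[ℂ] H} (hR : ∀ x ∈ R, star T * x * T ∈ R)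
    {x : H →L[ℂ] H} (hx : MonoSeqClosure R x) : MonoSeqClosure R (star T * x * T) :=
  hx.map (f := fun x ↦ star T * x * T) (fun _ _ h ↦ star_left_conjugate_le_conjugate h T)
    (fun _ _ h ↦ h.conj T) fun x hx ↦ .base _ (hR x hx)

/-- Translation by a fixed element preserves monotone limits, so additivity is inherited by the
closure one summand at a time. -/
lemma MonoSeqClosure.add [CompleteSpace H] (hR : ∀ x ∈ R, ∀ y ∈ R, x + y ∈ R) {x y : H →L[ℂ] H}
    (hx : MonoSeqClosure R x) (hy : MonoSeqClosure R y) : MonoSeqClosure R (x + y) := by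
  have translate (x : H →L[ℂ] H) (h : ∀ y ∈ R, MonoSeqClosure R (x + y)) {y : H →L[ℂ] H}
      (hy : MonoSeqClosure R y) : MonoSeqClosure R (x + y) :=
    hy.map (f := (x + ·)) (fun _ _ h ↦ add_le_add le_rfl h)
      (fun _ _ h ↦ (bddTendsto_const x).add h) h
  refine translate x (fun y hy ↦ ?_) hy
  rw [add_comm]
  exact translate y (fun x hx ↦ .base _ (hR y hy x hx)) hx

end MonotoneLimits

section Multipliers

universe u
/-! ### Multipliers in the enveloping von Neumann algebra -/

/-- The left action of a double centralizer is a right module map. -/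
lemma fst_mul {A : Type u} [NonUnitalCStarAlgebra A] (m : 𝓜(ℂ, A)) (a b : A) :
    m.fst (a * b) = m.fst a * b := by
  have h (x : A) : x * (m.fst (a * b) - m.fst a * b) = 0 := by
    rw [mul_sub, ← m.central, ← mul_assoc x, ← m.central, mul_assoc, sub_self]
  exact sub_eq_zero.mp (CStarRing.star_mul_self_eq_zero_iff _ |>.mp (h _))

variable {A : Type u} [NonUnitalCStarAlgebra A] [PartialOrder A] [StarOrderedRing A]

lemma multRep_mul_univRep (m : 𝓜(ℂ, A)) (a : A) :
    multRep m * univRep a = univRep (m.fst a) := by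
  ext ξ φ
  have : gnsMul φ.1 m * φ.1.gnsNonUnitalStarAlgHom a = φ.1.gnsNonUnitalStarAlgHom (m.fst a) :=
    gnsMul_ext φ.1 fun b ↦ by simp [gnsMul_coe, fst_mul]
  simpa [multRep, univRep] using DFunLike.congr_fun this (ξ φ)

lemma univRep_mul_multRep (m : 𝓜(ℂ, A)) (a : A) :
    univRep a * multRep m = univRep (m.snd a) := by
  have := congrArg star (multRep_mul_univRep (star m) (star a))
  simpa [← map_star] using this

lemma mem_bidual_iff {x : UnivSpace A →L[ℂ] UnivSpace A} :
    x ∈ bidual A ↔ ∀ S : UnivSpace A →L[ℂ] UnivSpace A,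
      (∀ a, univRep a * S = S * univRep a) → S * x = x * S := by
  change x ∈ StarSubalgebra.centralizer ℂ _ ↔ _
  rw [StarSubalgebra.mem_centralizer_iff]
  refine ⟨fun h S hS ↦ (h S ?_).1, fun h S hS ↦ ?_⟩
  · rw [SetLike.mem_coe, StarSubalgebra.mem_centralizer_iff]
    rintro _ ⟨a, rfl⟩
    exact ⟨hS a, by rw [← map_star]; exact hS _⟩
  · rw [SetLike.mem_coe, StarSubalgebra.mem_centralizer_iff] at hS
    refine ⟨h S fun a ↦ (hS _ ⟨a, rfl⟩).1, h _ fun a ↦ ?_⟩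
    have := congrArg star (hS _ ⟨a, rfl⟩).2
    simpa using this.symm

/-- The universal representation is nondegenerate. -/
lemma eq_zero_of_mul_univRep {D : UnivSpace A →L[ℂ] UnivSpace A}
    (hD : ∀ a, D * univRep a = 0) : D = 0 := by
  classical
  have hl := CStarAlgebra.increasingApproximateUnit A
  have hvec (φ : StateSpace A) (v : φ.1.GNS) : D (lp.single 2 φ v) = 0 := by
    induction v using UniformSpace.Completion.induction_on with
    | hp =>
      refine isClosed_eq (D.continuous.comp ?_) continuous_const
      exact (lp.isometry_single φ).continuous
    | ih b =>
      have hcont : Continuous fun a : A ↦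
          D (lp.single 2 φ ((φ.1.toPreGNS a : φ.1.PreGNS) : φ.1.GNS)) := by
        simp_rw [← gns_cyclicVector]
        refine D.continuous.comp ((lp.isometry_single φ).continuous.comp ?_)
        have : Continuous φ.1.gnsNonUnitalStarAlgHom := map_continuous _
        fun_prop
      have ht := (hcont.tendsto _).comp (hl.tendsto_mul_right (φ.1.ofPreGNS b))
      have hN := hl.neBot
      refine tendsto_nhds_unique ht (tendsto_const_nhds.congr fun e ↦ ?_)
      have hs : univRep e (lp.single 2 φ (b : φ.1.GNS)) =
          lp.single 2 φ ((φ.1.toPreGNS (e * φ.1.ofPreGNS b) : φ.1.PreGNS) : φ.1.GNS) := by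
        ext ψ
        rcases eq_or_ne ψ φ with rfl | hne
        · simp [univRep]
        · simp [univRep, hne]
      simpa [hs] using (DFunLike.congr_fun (hD e) (lp.single 2 φ (b : φ.1.GNS))).symm
  ext1 ξ
  have hs := (lp.hasSum_single (p := 2) (by simp) ξ).mapL D
  simp only [hvec] at hs
  exact hs.unique hasSum_zero

lemma multRep_mem_bidual (m : 𝓜(ℂ, A)) : multRep m ∈ bidual A := by
  refine mem_bidual_iff.mpr fun S hS ↦ sub_eq_zero.mp (eq_zero_of_mul_univRep fun a ↦ ?_)
  rw [sub_mul, mul_assoc, mul_assoc, multRep_mul_univRep, ← hS, ← hS, ← mul_assoc,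
    multRep_mul_univRep, sub_self]

lemma conj_mem_bidual (m : 𝓜(ℂ, A)) {x : UnivSpace A →L[ℂ] UnivSpace A} (hx : x ∈ bidual A) :
    star (multRep m) * x * multRep m ∈ bidual A :=
  mul_mem (mul_mem (star_mem (multRep_mem_bidual m)) hx) (multRep_mem_bidual m)

lemma univRep_mem_bidual (a : A) : univRep a ∈ bidual A :=
  mem_bidual_iff.mpr fun _ hS ↦ (hS a).symm

lemma isClosed_bidual : IsClosed (bidual A : Set (UnivSpace A →L[ℂ] UnivSpace A)) := by
  have : (bidual A : Set (UnivSpace A →L[ℂ] UnivSpace A)) =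
      ⋂ S, ⋂ (_ : ∀ a, univRep a * S = S * univRep a), {x | S * x = x * S} := by
    ext x
    simp only [Set.mem_iInter, SetLike.mem_coe, mem_bidual_iff, Set.mem_ofPred_eq]
  rw [this]
  exact isClosed_iInter fun S ↦ isClosed_iInter fun _ ↦ isClosed_eq (by fun_prop) (by fun_prop)

lemma BddTendsto.mem_bidual {ι : Type*} {l : Filter ι} [l.NeBot]
    {a : ι → UnivSpace A →L[ℂ] UnivSpace A} {x : UnivSpace A →L[ℂ] UnivSpace A}
    (ha : BddTendsto l a x) (h : ∀ i, a i ∈ bidual A) : x ∈ bidual A :=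
  mem_bidual_iff.mpr fun S hS ↦ ha.commute fun i ↦ mem_bidual_iff.mp (h i) S hS

/-! ### Semicontinuous elements -/

lemma conj_mem_selfAdjointImage (m : 𝓜(ℂ, A)) :
    ∀ x ∈ selfAdjointImage A, star (multRep m) * x * multRep m ∈ selfAdjointImage A := by
  rintro _ ⟨a, ha, rfl⟩
  set b := m.snd ((star m).fst a)
  have hb : star (multRep m) * univRep a * multRep m = univRep b := by
    rw [← map_star, multRep_mul_univRep, univRep_mul_multRep]
  have hsa : star (univRep b) = univRep b := by
    rw [← hb, (ha.map univRep).conjugate' (multRep m) |>.star_eq]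
  -- replacing `b` by its real part does not change the image, so injectivity is not needed
  refine ⟨(2⁻¹ : ℝ) • (b + star b), IsSelfAdjoint.smul (.all _) (.add_star_self b), ?_⟩
  rw [hb, ← Complex.coe_smul, map_smul, map_add, map_star, hsa, ← two_smul ℂ, smul_smul]
  simp

lemma add_mem_stronglyLSC {x y : UnivSpace A →L[ℂ] UnivSpace A} (hx : x ∈ stronglyLSC A)
    (hy : y ∈ stronglyLSC A) : x + y ∈ stronglyLSC A := by
  refine map_mem_closure₂ (s := monoLimits (selfAdjointImage A))
    (t := monoLimits (selfAdjointImage A)) continuous_add hx hy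
    fun a ha b hb ↦ add_mem_monoLimits ?_ ha hb
  rintro _ ⟨a, ha, rfl⟩ _ ⟨b, hb, rfl⟩
  exact ⟨a + b, ha.add hb, (map_add _ _ _).symm⟩

lemma add_mem_stronglyUSC {x y : UnivSpace A →L[ℂ] UnivSpace A} (hx : x ∈ stronglyUSC A)
    (hy : y ∈ stronglyUSC A) : x + y ∈ stronglyUSC A := by
  change -(x + y) ∈ stronglyLSC A
  rw [neg_add]
  exact add_mem_stronglyLSC hx hy

lemma zero_mem_stronglyLSC : (0 : UnivSpace A →L[ℂ] UnivSpace A) ∈ stronglyLSC A :=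
  subset_closure ⟨PUnit, inferInstance, inferInstance, inferInstance, fun _ ↦ 0, monotone_const,
    fun _ ↦ ⟨0, .zero _, (map_zero _).symm⟩, bddTendsto_const 0⟩

lemma isMultiplierInvariant_closure {V : Set (UnivSpace A →L[ℂ] UnivSpace A)}
    (hV : IsMultiplierInvariant V) : IsMultiplierInvariant (closure V) :=
  fun m _ hx ↦ map_mem_closure (s := V) (f := fun x ↦ star (multRep m) * x * multRep m)
    (by fun_prop) hx (hV m)

lemma isMultiplierInvariant_stronglyLSC : IsMultiplierInvariant (stronglyLSC A) :=
  isMultiplierInvariant_closure fun m _ hx ↦ conj_mem_monoLimits (conj_mem_selfAdjointImage m) hx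

lemma isMultiplierInvariant_stronglyUSC : IsMultiplierInvariant (stronglyUSC A) := by
  intro m x hx
  change -(star (multRep m) * x * multRep m) ∈ stronglyLSC A
  rw [← neg_mul, ← mul_neg]
  exact isMultiplierInvariant_stronglyLSC m _ hx

lemma stronglyLSC_subset_bidual : stronglyLSC A ⊆ bidual A := by
  refine closure_minimal ?_ isClosed_bidual
  rintro x ⟨ι, _, _, _, a, -, haR, ha⟩
  refine ha.mem_bidual fun i ↦ ?_
  obtain ⟨b, -, hb⟩ := haR i
  exact hb ▸ univRep_mem_bidual b

/-! ### Vector functionals -/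

/-- The positive functional `a ↦ ⟪ξ, π(a) ξ⟫` given by a vector `ξ` of the universal space. -/
noncomputable def vectorFunctional (ξ : UnivSpace A) : A →ₚ[ℂ] ℂ :=
  .mk₀
    ((innerSL ℂ ξ ∘L ContinuousLinearMap.apply ℂ _ ξ).toLinearMap.comp
      (univRep (A := A) : A →ₗ[ℂ] UnivSpace A →L[ℂ] UnivSpace A))
    fun a ha ↦ by
      obtain ⟨b, rfl⟩ := CStarAlgebra.nonneg_iff_eq_star_mul_self.mp ha
      change 0 ≤ ⟪ξ, univRep (star b * b) ξ⟫_ℂ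
      rw [map_mul, map_star, ContinuousLinearMap.star_eq_adjoint, mul_apply_eq_comp,
        ContinuousLinearMap.adjoint_inner_right, inner_self_eq_norm_sq_to_K]
      norm_cast
      exact Complex.zero_le_real.mpr (sq_nonneg ‖univRep b ξ‖)

lemma vectorFunctional_apply (ξ : UnivSpace A) (a : A) :
    vectorFunctional ξ a = ⟪ξ, univRep a ξ⟫_ℂ := rfl

/-- A vector functional is, on `A`, a nonnegative multiple of a state. The given state serves
when the functional vanishes, since an arbitrary `A` need not have states. -/
lemma exists_state_vectorFunctional (φ : StateSpace A) (ξ : UnivSpace A) :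
    ∃ ψ : StateSpace A, ∃ c : ℝ, 0 ≤ c ∧ ∀ a, vectorFunctional ξ a = c * ψ.1 a := by
  set F : UnivSpace A → A →L[ℂ] ℂ := fun η ↦
    ⟨(vectorFunctional η).toLinearMap, map_continuous (vectorFunctional η)⟩
  have hF (η a) : F η a = vectorFunctional η a := rfl
  rcases eq_or_ne (F ξ) 0 with h0 | h0
  · refine ⟨φ, 0, le_rfl, fun a ↦ ?_⟩
    rw [← hF, h0]
    simp
  have hpos : 0 < ‖F ξ‖ := norm_pos_iff.mpr h0
  -- the vector `r ξ` has the functional `r² F ξ`, of norm one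
  set r : ℝ := (√‖F ξ‖)⁻¹
  have hr : r * r = ‖F ξ‖⁻¹ := by rw [← mul_inv, Real.mul_self_sqrt hpos.le]
  have hs : F ((r : ℂ) • ξ) = ((‖F ξ‖⁻¹ : ℝ) : ℂ) • F ξ := by
    ext a
    rw [hF, smul_apply, hF, vectorFunctional_apply, vectorFunctional_apply,
      map_smul, inner_smul_left, inner_smul_right, ← hr]
    simp [mul_assoc]
  refine ⟨⟨vectorFunctional ((r : ℂ) • ξ), ?_⟩, ‖F ξ‖, hpos.le, fun a ↦ ?_⟩
  · change ‖F ((r : ℂ) • ξ)‖ = 1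
    rw [hs, norm_smul, Complex.norm_real, norm_inv, norm_norm, inv_mul_cancel₀ hpos.ne']
  · change F ξ a = ‖F ξ‖ * F ((r : ℂ) • ξ) a
    rw [hs, smul_apply, smul_eq_mul, ← mul_assoc, ← Complex.ofReal_mul,
      mul_inv_cancel₀ hpos.ne', Complex.ofReal_one, one_mul]

/-- On semicontinuous elements a vector functional is a nonnegative multiple of the normal
extension of a state: the two agree on `A`, and both are strongly continuous. -/
lemma exists_state_inner (φ : StateSpace A) (ξ : UnivSpace A) :
    ∃ ψ : StateSpace A, ∃ c : ℝ, 0 ≤ c ∧ ∀ h ∈ stronglyLSC A, ⟪ξ, h ξ⟫_ℂ = c * ψ.ext h := by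
  obtain ⟨ψ, c, hc, hψ⟩ := exists_state_vectorFunctional φ ξ
  refine ⟨ψ, c, hc, fun h hh ↦ ?_⟩
  have hclosed : IsClosed
      {x : UnivSpace A →L[ℂ] UnivSpace A | ⟪ξ, x ξ⟫_ℂ = c * ψ.ext x} := by
    unfold StateSpace.ext
    exact isClosed_eq (by fun_prop) (by fun_prop)
  refine closure_minimal ?_ hclosed hh
  rintro x ⟨ι, _, _, _, a, -, haR, ha⟩
  refine tendsto_nhds_unique (ha.inner_tendsto ξ ξ) ?_
  have h2 : Tendsto (fun i ↦ ψ.ext (a i)) atTop (𝓝 (ψ.ext x)) := ha.inner_tendsto _ _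
  refine (h2.const_mul (c : ℂ)).congr fun i ↦ ?_
  obtain ⟨b, -, hb⟩ := haR i
  rw [hb, ψ.ext_univRep, ← hψ b, vectorFunctional_apply]

lemma StateSpace.ext_add (φ : StateSpace A) (x y : UnivSpace A →L[ℂ] UnivSpace A) :
    φ.ext (x + y) = φ.ext x + φ.ext y := by
  simp [StateSpace.ext]

lemma StateSpace.ext_neg (φ : StateSpace A) (x : UnivSpace A →L[ℂ] UnivSpace A) :
    φ.ext (-x) = -φ.ext x := by
  simp [StateSpace.ext]

/-- The functional `φ(T* · T)`, on semicontinuous elements, is a multiple of a state. -/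
lemma StateSpace.exists_ext_conj (φ : StateSpace A) (m : 𝓜(ℂ, A)) :
    ∃ ψ : StateSpace A, ∃ c : ℝ, 0 ≤ c ∧ ∀ h ∈ stronglyLSC A, ∀ k ∈ stronglyUSC A,
      φ.ext (star (multRep m) * (h - k) * multRep m) = c * ψ.ext (h - k) := by
  classical
  obtain ⟨ψ, c, hc, hψ⟩ := exists_state_inner φ (multRep m (lp.single 2 φ (cyclicVector φ.1)))
  refine ⟨ψ, c, hc, fun h hh k hk ↦ ?_⟩
  rw [← hψ _ (sub_eq_add_neg h k ▸ add_mem_stronglyLSC hh hk), StateSpace.ext]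
  simp only [ContinuousLinearMap.star_eq_adjoint, mul_apply_eq_comp,
    ContinuousLinearMap.adjoint_inner_right]

/-! ### Universally measurable elements -/

/-- The self-adjoint `x ∈ A**` is approximated from both sides, for every state, by
semicontinuous elements taken from the set `N`. With no condition on `N` this is membership in `𝒰`,
with `N` bounded membership in `𝒰_b`. -/
def IsSandwiched (N : Set (UnivSpace A →L[ℂ] UnivSpace A))
    (x : UnivSpace A →L[ℂ] UnivSpace A) : Prop :=
  x ∈ bidual A ∧ IsSelfAdjoint x ∧ ∀ φ : StateSpace A, ∀ ε : ℝ, 0 < ε →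
    ∃ h ∈ stronglyLSC A, ∃ k ∈ stronglyUSC A, k ≤ x ∧ x ≤ h ∧ (φ.ext (h - k)).re < ε ∧
      h ∈ N ∧ k ∈ N

lemma mem_univMeas_iff {x : UnivSpace A →L[ℂ] UnivSpace A} :
    x ∈ univMeas A ↔ ∃ N, IsSandwiched N x := by
  refine ⟨fun h ↦ ⟨Set.univ, by simpa [IsSandwiched, univMeas] using h⟩, ?_⟩
  rintro ⟨N, hx, hsa, h⟩
  refine ⟨hx, hsa, fun φ ε hε ↦ ?_⟩
  obtain ⟨h, hh, k, hk, h1, h2, h3, -⟩ := h φ ε hε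
  exact ⟨h, hh, k, hk, h1, h2, h3⟩

lemma mem_univMeasBdd_iff {x : UnivSpace A →L[ℂ] UnivSpace A} :
    x ∈ univMeasBdd A ↔ ∃ N, Bornology.IsBounded N ∧ IsSandwiched N x := by
  constructor
  · rintro ⟨hx, hsa, γ, h⟩
    exact ⟨Metric.closedBall 0 γ, Metric.isBounded_closedBall, hx, hsa, by simpa using h⟩
  · rintro ⟨N, hN, hx, hsa, h⟩
    obtain ⟨γ, hγ⟩ := hN.exists_norm_le
    refine ⟨hx, hsa, γ, fun φ ε hε ↦ ?_⟩
    obtain ⟨h, hh, k, hk, h1, h2, h3, h4, h5⟩ := h φ ε hε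
    exact ⟨h, hh, k, hk, h1, h2, h3, hγ _ h4, hγ _ h5⟩

open scoped Pointwise

variable {N N' : Set (UnivSpace A →L[ℂ] UnivSpace A)} {x y : UnivSpace A →L[ℂ] UnivSpace A}

lemma isSandwiched_zero : IsSandwiched (A := A) {0} 0 :=
  ⟨zero_mem _, .zero _, fun φ ε hε ↦ ⟨0, zero_mem_stronglyLSC, 0,
    by simpa [stronglyUSC] using zero_mem_stronglyLSC, le_rfl, le_rfl,
    by simpa [StateSpace.ext] using hε, rfl, rfl⟩⟩

lemma IsSandwiched.add (hx : IsSandwiched N x) (hy : IsSandwiched N' y) :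
    IsSandwiched (N + N') (x + y) := by
  obtain ⟨hxb, hxs, hx⟩ := hx
  obtain ⟨hyb, hys, hy⟩ := hy
  refine ⟨add_mem hxb hyb, hxs.add hys, fun φ ε hε ↦ ?_⟩
  obtain ⟨h, hh, k, hk, hkx, hxh, hφ, hhN, hkN⟩ := hx φ (ε / 2) (half_pos hε)
  obtain ⟨h', hh', k', hk', hky, hyh, hφ', hhN', hkN'⟩ := hy φ (ε / 2) (half_pos hε)
  refine ⟨h + h', add_mem_stronglyLSC hh hh', k + k', add_mem_stronglyUSC hk hk',
    add_le_add hkx hky, add_le_add hxh hyh, ?_, Set.add_mem_add hhN hhN',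
    Set.add_mem_add hkN hkN'⟩
  rw [add_sub_add_comm, φ.ext_add, Complex.add_re]
  linarith

lemma IsSandwiched.neg (hx : IsSandwiched N x) : IsSandwiched (-N) (-x) := by
  obtain ⟨hxb, hxs, hx⟩ := hx
  refine ⟨neg_mem hxb, hxs.neg, fun φ ε hε ↦ ?_⟩
  obtain ⟨h, hh, k, hk, hkx, hxh, hφ, hhN, hkN⟩ := hx φ ε hε
  refine ⟨-k, hk, -h, by simpa [stronglyUSC] using hh, neg_le_neg hxh, neg_le_neg hkx, ?_,
    by simpa using hkN, by simpa using hhN⟩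
  rwa [neg_sub_neg]

lemma IsSandwiched.conj (hx : IsSandwiched N x) (m : 𝓜(ℂ, A)) :
    IsSandwiched ((fun z ↦ star (multRep m) * z * multRep m) '' N)
      (star (multRep m) * x * multRep m) := by
  obtain ⟨hxb, hxs, hx⟩ := hx
  refine ⟨conj_mem_bidual m hxb, hxs.conjugate' _, fun φ ε hε ↦ ?_⟩
  obtain ⟨ψ, c, hc, hψ⟩ := φ.exists_ext_conj m
  obtain ⟨h, hh, k, hk, hkx, hxh, hlt, hhN, hkN⟩ := hx ψ (ε / (c + 1)) (by positivity)
  refine ⟨_, isMultiplierInvariant_stronglyLSC m h hh, _,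
    isMultiplierInvariant_stronglyUSC m k hk, star_left_conjugate_le_conjugate hkx _,
    star_left_conjugate_le_conjugate hxh _, ?_, ⟨h, hhN, rfl⟩, ⟨k, hkN, rfl⟩⟩
  rw [← sub_mul, ← mul_sub, hψ h hh k hk, Complex.re_ofReal_mul]
  calc c * (ψ.ext (h - k)).re ≤ c * (ε / (c + 1)) := by gcongr
    _ < ε := by
      rw [mul_div_assoc', div_lt_iff₀ (by positivity)]
      linarith

/-! ### From invariant real subspaces to bimodules -/

lemma star_mul_mul_eq_polarization {B : Type*} [Ring B] [StarRing B] [Algebra ℂ B]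
    [StarModule ℂ B] (t x s : B) :
    star t * x * s =
      (4⁻¹ : ℂ) • (star (s + t) * x * (s + t)) +
      (4⁻¹ * Complex.I : ℂ) • (star (s + Complex.I • t) * x * (s + Complex.I • t)) +
      (-4⁻¹ : ℂ) • (star (s + (-1 : ℂ) • t) * x * (s + (-1 : ℂ) • t)) +
      (-4⁻¹ * Complex.I : ℂ) •
        (star (s + (-Complex.I) • t) * x * (s + (-Complex.I) • t)) := by
  simp only [star_add, star_smul, mul_add, add_mul, smul_mul_assoc, mul_smul_comm, smul_add,
    smul_smul]
  match_scalars <;> apply Complex.ext <;> norm_num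

/-- For a set `V` which is an additive subgroup of `A**` mapped into itself by every `x ↦ T* x T`,
the complexification is a bimodule. Multiplication by `c ≥ 0` is the case `T = √c` of the
invariance, and `x T` and `T x` are obtained by polarization. -/
lemma isMultiplierBimodule_complexification {V : Set (UnivSpace A →L[ℂ] UnivSpace A)}
    (hb : V ⊆ bidual A) (h0 : 0 ∈ V) (hadd : ∀ x ∈ V, ∀ y ∈ V, x + y ∈ V)
    (hneg : ∀ x ∈ V, -x ∈ V) (hinv : IsMultiplierInvariant V) :
    IsMultiplierBimodule (complexification V) := by
  have hpos (c : ℝ) (hc : 0 ≤ c) (x) (hx : x ∈ V) : (c : ℂ) • x ∈ V := by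
    -- conjugate by the scalar multiplier `√c`
    have := hinv (algebraMap ℂ _ (√c : ℝ)) x hx
    rw [AlgHomClass.commutes, ← algebraMap_star_comm, ← Algebra.commutes, ← mul_assoc, ← map_mul,
      ← Algebra.smul_def] at this
    simpa [← Complex.ofReal_mul, Real.mul_self_sqrt hc] using this
  have hreal (c : ℝ) (x) (hx : x ∈ V) : (c : ℂ) • x ∈ V := by
    rcases le_total 0 c with hc | hc
    · exact hpos c hc x hx
    · simpa using hneg _ (hpos (-c) (by linarith) x hx)
  have hCadd : ∀ x ∈ complexification V, ∀ y ∈ complexification V,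
      x + y ∈ complexification V := by
    rintro _ ⟨a, ha, b, hb, rfl⟩ _ ⟨c, hc, d, hd, rfl⟩
    exact ⟨_, hadd a ha c hc, _, hadd b hb d hd, by module⟩
  have hCsmul : ∀ c : ℂ, ∀ x ∈ complexification V, c • x ∈ complexification V := by
    rintro c _ ⟨a, ha, b, hb, rfl⟩
    refine ⟨_, hadd _ (hreal c.re a ha) _ (hreal (-c.im) b hb), _,
      hadd _ (hreal c.re b hb) _ (hreal c.im a ha), ?_⟩
    match_scalars <;> apply Complex.ext <;> simp
  have hV (x) (hx : x ∈ V) : x ∈ complexification V := ⟨x, hx, 0, h0, by simp⟩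
  have hpol (s t : 𝓜(ℂ, A)) (x) (hx : x ∈ V) :
      star (multRep t) * x * multRep s ∈ complexification V := by
    rw [star_mul_mul_eq_polarization]
    simp only [← map_smul, ← map_add]
    exact hCadd _ (hCadd _ (hCadd _ (hCsmul _ _ (hV _ (hinv _ x hx))) _
      (hCsmul _ _ (hV _ (hinv _ x hx)))) _ (hCsmul _ _ (hV _ (hinv _ x hx)))) _
      (hCsmul _ _ (hV _ (hinv _ x hx)))
  refine ⟨?_, hV 0 h0, hCadd, hCsmul, ?_, ?_⟩
  · rintro _ ⟨a, ha, b, hb', rfl⟩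
    exact add_mem (hb ha) (SMulMemClass.smul_mem (s := (bidual A).toStarSubalgebra) _ (hb hb'))
  · rintro m _ ⟨a, ha, b, hb, rfl⟩
    rw [mul_add, mul_smul_comm]
    have h (x) (hx : x ∈ V) : multRep m * x ∈ complexification V := by
      simpa only [map_star, star_star, map_one, mul_one] using hpol 1 (star m) x hx
    exact hCadd _ (h a ha) _ (hCsmul _ _ (h b hb))
  · rintro m _ ⟨a, ha, b, hb, rfl⟩
    rw [add_mul, smul_mul_assoc]
    have h (x) (hx : x ∈ V) : x * multRep m ∈ complexification V := by
      simpa using hpol m 1 x hx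
    exact hCadd _ (h a ha) _ (hCsmul _ _ (h b hb))

end Multipliers

end EnvelopingVN

namespace EnvelopingVN

section Spaces

universe u
variable {A : Type u} [NonUnitalCStarAlgebra A] [PartialOrder A] [StarOrderedRing A]

/-! ### The five spaces -/

lemma isMultiplierInvariant_span {V : Set (UnivSpace A →L[ℂ] UnivSpace A)}
    (hV : IsMultiplierInvariant V) :
    IsMultiplierInvariant (Submodule.span ℝ V : Set (UnivSpace A →L[ℂ] UnivSpace A)) := by
  intro m x hx
  simp only [SetLike.mem_coe] at hx ⊢
  induction hx using Submodule.span_induction with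
  | mem x hx => exact Submodule.subset_span (hV m x hx)
  | zero => simp
  | add x y _ _ hx hy => simpa [mul_add, add_mul] using add_mem hx hy
  | smul c x _ hx =>
    have h : star (multRep m) * (c • x) * multRep m = c • (star (multRep m) * x * multRep m) := by
      ext1 ξ
      exact ContinuousLinearMap.map_smul_of_tower (star (multRep m)) c (x (multRep m ξ))
    exact h ▸ Submodule.smul_mem _ c hx

lemma isMultiplierInvariant_Sbar : IsMultiplierInvariant (Sbar A) :=
  isMultiplierInvariant_closure (isMultiplierInvariant_span isMultiplierInvariant_stronglyLSC)

lemma isMultiplierBimodule_Sbar : IsMultiplierBimodule (complexification (Sbar A)) := by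
  let W := (Submodule.span ℝ (stronglyLSC A)).topologicalClosure
  refine isMultiplierBimodule_complexification (closure_minimal (fun x hx ↦ ?_) isClosed_bidual)
    W.zero_mem (fun x hx y hy ↦ W.add_mem hx hy) (fun x hx ↦ W.neg_mem hx)
    isMultiplierInvariant_Sbar
  simp only [SetLike.mem_coe] at hx ⊢
  induction hx using Submodule.span_induction with
  | mem x hx => exact stronglyLSC_subset_bidual hx
  | zero => exact zero_mem _
  | add x y _ _ hx hy => exact add_mem hx hy
  | smul c x _ hx =>
    exact SMulMemClass.smul_mem (s := (bidual A).toStarSubalgebra) (c : ℂ) hx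

lemma univMeas_subset_bidual : univMeas A ⊆ bidual A := fun _ hx ↦ hx.1

lemma isMultiplierInvariant_univMeas : IsMultiplierInvariant (univMeas A) := by
  intro m x hx
  obtain ⟨N, hN⟩ := mem_univMeas_iff.mp hx
  exact mem_univMeas_iff.mpr ⟨_, hN.conj m⟩

lemma isMultiplierBimodule_univMeas : IsMultiplierBimodule (complexification (univMeas A)) := by
  refine isMultiplierBimodule_complexification univMeas_subset_bidual
    (mem_univMeas_iff.mpr ⟨_, isSandwiched_zero⟩) (fun x hx y hy ↦ ?_) (fun x hx ↦ ?_)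
    isMultiplierInvariant_univMeas
  · obtain ⟨N, hN⟩ := mem_univMeas_iff.mp hx
    obtain ⟨N', hN'⟩ := mem_univMeas_iff.mp hy
    exact mem_univMeas_iff.mpr ⟨_, hN.add hN'⟩
  · obtain ⟨N, hN⟩ := mem_univMeas_iff.mp hx
    exact mem_univMeas_iff.mpr ⟨_, hN.neg⟩

lemma univMeasBdd_subset_bidual : univMeasBdd A ⊆ bidual A := fun _ hx ↦ hx.1

lemma zero_mem_univMeasBdd : (0 : UnivSpace A →L[ℂ] UnivSpace A) ∈ univMeasBdd A :=
  mem_univMeasBdd_iff.mpr ⟨_, Bornology.isBounded_singleton, isSandwiched_zero⟩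

lemma add_mem_univMeasBdd :
    ∀ x ∈ univMeasBdd A, ∀ y ∈ univMeasBdd A, x + y ∈ univMeasBdd A := by
  intro x hx y hy
  obtain ⟨N, hb, hN⟩ := mem_univMeasBdd_iff.mp hx
  obtain ⟨N', hb', hN'⟩ := mem_univMeasBdd_iff.mp hy
  exact mem_univMeasBdd_iff.mpr ⟨_, hb.add hb', hN.add hN'⟩

lemma neg_mem_univMeasBdd : ∀ x ∈ univMeasBdd A, -x ∈ univMeasBdd A := by
  intro x hx
  obtain ⟨N, hb, hN⟩ := mem_univMeasBdd_iff.mp hx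
  exact mem_univMeasBdd_iff.mpr ⟨_, hb.neg, hN.neg⟩

lemma isMultiplierInvariant_univMeasBdd : IsMultiplierInvariant (univMeasBdd A) := by
  intro m x hx
  obtain ⟨N, hb, hN⟩ := mem_univMeasBdd_iff.mp hx
  refine mem_univMeasBdd_iff.mpr ⟨_, ?_, hN.conj m⟩
  exact (ContinuousLinearMap.mulLeftRight ℂ (UnivSpace A →L[ℂ] UnivSpace A)
    (star (multRep m)) (multRep m)).lipschitz.isBounded_image hb

lemma isMultiplierBimodule_univMeasBdd :
    IsMultiplierBimodule (complexification (univMeasBdd A)) :=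
  isMultiplierBimodule_complexification univMeasBdd_subset_bidual zero_mem_univMeasBdd
    add_mem_univMeasBdd neg_mem_univMeasBdd isMultiplierInvariant_univMeasBdd

lemma isMultiplierInvariant_univMeasBddBar : IsMultiplierInvariant (univMeasBddBar A) :=
  isMultiplierInvariant_closure isMultiplierInvariant_univMeasBdd

lemma isMultiplierBimodule_univMeasBddBar :
    IsMultiplierBimodule (complexification (univMeasBddBar A)) :=
  isMultiplierBimodule_complexification
    (closure_minimal univMeasBdd_subset_bidual isClosed_bidual)
    (subset_closure zero_mem_univMeasBdd)
    (fun _ hx _ hy ↦ map_mem_closure₂ (s := univMeasBdd A) (t := univMeasBdd A) continuous_add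
      hx hy add_mem_univMeasBdd)
    (fun _ hx ↦ map_mem_closure (s := univMeasBdd A) continuous_neg hx neg_mem_univMeasBdd)
    isMultiplierInvariant_univMeasBddBar

lemma univMeasZero_subset_bidual : univMeasZero A ⊆ bidual A := by
  intro x hx
  change MonoSeqClosure (univMeasBdd A) x at hx
  induction hx with
  | base x hx => exact univMeasBdd_subset_bidual hx
  | incr a x _ _ ha ih => exact ha.mem_bidual ih
  | decr a x _ _ ha ih => exact ha.mem_bidual ih

lemma isMultiplierInvariant_univMeasZero : IsMultiplierInvariant (univMeasZero A) :=
  fun m _ hx ↦ MonoSeqClosure.conj (isMultiplierInvariant_univMeasBdd m) hx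

lemma isMultiplierBimodule_univMeasZero :
    IsMultiplierBimodule (complexification (univMeasZero A)) :=
  isMultiplierBimodule_complexification univMeasZero_subset_bidual
    (.base _ zero_mem_univMeasBdd) (fun _ hx _ hy ↦ MonoSeqClosure.add add_mem_univMeasBdd hx hy)
    (fun _ hx ↦ MonoSeqClosure.neg neg_mem_univMeasBdd hx) isMultiplierInvariant_univMeasZero

end Spaces

end EnvelopingVN

theorem proposition1 {A : Type*} [NonUnitalCStarAlgebra A] [PartialOrder A] [StarOrderedRing A] :
    (IsMultiplierBimodule (complexification (Sbar A)) ∧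
      IsMultiplierBimodule (complexification (univMeasBdd A)) ∧
      IsMultiplierBimodule (complexification (univMeasBddBar A)) ∧
      IsMultiplierBimodule (complexification (univMeasZero A)) ∧
      IsMultiplierBimodule (complexification (univMeas A))) ∧
    (IsMultiplierInvariant (stronglyLSC A) ∧
      IsMultiplierInvariant (stronglyUSC A) ∧
      IsMultiplierInvariant (Sbar A) ∧
      IsMultiplierInvariant (univMeasBdd A) ∧
      IsMultiplierInvariant (univMeasBddBar A) ∧
      IsMultiplierInvariant (univMeasZero A) ∧
      IsMultiplierInvariant (univMeas A)) :=
  ⟨⟨isMultiplierBimodule_Sbar, isMultiplierBimodule_univMeasBdd,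
      isMultiplierBimodule_univMeasBddBar, isMultiplierBimodule_univMeasZero,
      isMultiplierBimodule_univMeas⟩,
    isMultiplierInvariant_stronglyLSC, isMultiplierInvariant_stronglyUSC,
    isMultiplierInvariant_Sbar, isMultiplierInvariant_univMeasBdd,
    isMultiplierInvariant_univMeasBddBar, isMultiplierInvariant_univMeasZero,
    isMultiplierInvariant_univMeas⟩
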